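/- Let $a,d\in\mathbb N^2$ be linearly independent over $\mathbb Q$, let $k\ge 2$, and let $S=S_{a,d,k}=\langle a,a+d,\dots,a+kd\rangle\subseteq\mathbb N^2$ be the monoid generated by $a,a+d,\dots,a+kd$, where this sequence is assumed to be a minimal generating set of $S$. Let $E$ be the set of extremal rays of $S$, that is, of the componentwise smallest nonzero elements of $S$ on the extremal rays of the real cone generated by $S$. For $x,y\in\mathbb N^2$ write $x\preceq y$ if $y-x\in S$. Let $\mathrm{Ap}(S,E)=\{b\in S : b-e\notin S \text{ for all } e\in E\}$, and let $\mathrm{QF}(S)=\{\,b-\sum_{e\in E}e : b \text{ is a } \preceq\text{-maximal element of } \mathrm{Ap}(S,E)\,\}\subseteq\mathbb Z^2$ be the set of quasi-Frobenius elements of $S$. Then $S$ is a simplicial affine semigroup (it contains two $\mathbb Q$-linearly independent elements $e_1,e_2$ such that every $s\in S$ has a multiple $\alpha s$, $0\ne\alpha\in\mathbb N$, in $\mathbb N e_1+\mathbb N e_2$), and $$\mathrm{QF}(S_{a,d,k})=\{-(a+d),-(a+2d),\dots,-(a+(k-1)d)\}.$$ Moreover, for every field $K$, the semigroup ring $K[S]=\bigoplus_{s\in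 S}K\mathbf t^s$ has Cohen–Macaulay type $k-1$; that is, the localization $R$ of $K[S]$ at its graded maximal ideal $\bigoplus_{0\neq s\in S}K\mathbf t^s$ is a Cohen–Macaulay local ring, and $\dim_\kappa\operatorname{Ext}^{t}_R(\kappa,R)=k-1$, where $\kappa$ is the residue field of $R$ and $t=\operatorname{depth}R$. -/

import Mathlib

/-! ### Affine semigroups in `ℕ ^ r` -/

namespace AffineSemigroup

variable {r : ℕ}

/-- `X` is a minimal generating set of the monoid `S`: it generates `S`, and no proper subset
of `X` does. -/
def IsMinimalGeneratingSet (S : AddSubmonoid (Fin r → ℕ)) (X : Set (Fin r → ℕ)) : Prop :=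
  AddSubmonoid.closure X = S ∧ ∀ Y : Set (Fin r → ℕ), Y ⊂ X → AddSubmonoid.closure Y ≠ S

/-- An element of `ℕ ^ r`, seen in `ℝ ^ r`. -/
def toReal (s : Fin r → ℕ) : Fin r → ℝ := fun i => (s i : ℝ)

/-- An element of `ℕ ^ r`, seen in `ℚ ^ r`. -/
def toRat (s : Fin r → ℕ) : Fin r → ℚ := fun i => (s i : ℚ)

/-- An element of `ℕ ^ r`, seen in `ℤ ^ r`. -/
def toInt (s : Fin r → ℕ) : Fin r → ℤ := fun i => (s i : ℤ)

/-- `S` is simplicial: it contains `r` elements that are linearly independent over `ℚ`, such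
that every element of `S` has a nonzero multiple in the monoid that they generate. -/
def IsSimplicial (S : AddSubmonoid (Fin r → ℕ)) : Prop :=
  ∃ e : Fin r → (Fin r → ℕ), (∀ j, e j ∈ S) ∧
    LinearIndependent ℚ (fun j => toRat (e j)) ∧
    ∀ s ∈ S, ∃ α : ℕ, α ≠ 0 ∧ ∃ l : Fin r → ℕ, α • s = ∑ j, l j • e j

/-- The cone in `ℝ ^ r` of all nonnegative real combinations of elements of `S`. -/
def cone (S : AddSubmonoid (Fin r → ℕ)) : PointedCone ℝ (Fin r → ℝ) :=
  PointedCone.hull ℝ (toReal '' (S : Set (Fin r → ℕ)))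

/-- The ray of all nonnegative real multiples of `e`. -/
def ray (e : Fin r → ℕ) : Set (Fin r → ℝ) :=
  {x | ∃ t : ℝ, 0 ≤ t ∧ x = t • toReal e}

/-- The set `E` of the extremal rays of `S`, in the sense of affine semigroups: on each extremal
ray of the cone of `S`, the componentwise smallest nonzero element of `S`. -/
def extremalRays (S : AddSubmonoid (Fin r → ℕ)) : Set (Fin r → ℕ) :=
  {e | e ∈ S ∧ e ≠ 0 ∧ IsExtreme ℝ (cone S : Set (Fin r → ℝ)) (ray e) ∧
    ∀ s ∈ S, s ≠ 0 → toReal s ∈ ray e → e ≤ s}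

/-- The order `x ≼ y` on `ℕ ^ r` defined by `y - x ∈ S` (the difference being taken in
`ℤ ^ r`). -/
def SLE (S : AddSubmonoid (Fin r → ℕ)) (x y : Fin r → ℕ) : Prop :=
  ∃ s ∈ S, x + s = y

/-- The Apéry set `{b ∈ S | b - e ∉ S for all e ∈ E}`. -/
def apery (S : AddSubmonoid (Fin r → ℕ)) (E : Set (Fin r → ℕ)) : Set (Fin r → ℕ) :=
  {b | b ∈ S ∧ ∀ e ∈ E, ¬ SLE S e b}

/-- The elements of the Apéry set of `S` with respect to `E` that are maximal for `≼`. -/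
def maxApery (S : AddSubmonoid (Fin r → ℕ)) (E : Set (Fin r → ℕ)) : Set (Fin r → ℕ) :=
  {b | b ∈ apery S E ∧ ∀ c ∈ apery S E, SLE S b c → c = b}

/-- The quasi-Frobenius elements of `S`: the vectors `b - ∑_{e ∈ E} e` in `ℤ ^ r`, where `E` is
the set of extremal rays of `S` and `b` is a maximal element of the Apéry set. -/
noncomputable def QF (S : AddSubmonoid (Fin r → ℕ)) : Set (Fin r → ℤ) :=
  {f | ∃ b ∈ maxApery S (extremalRays S), f = toInt b - ∑ᶠ e ∈ extremalRays S, toInt e}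

end AffineSemigroup

/-! ### The Cohen-Macaulay property and type of a local ring -/

namespace LocalCM

universe u

variable (R : Type u) [CommRing R] [IsLocalRing R]

/-- The depth of a local ring: the supremum of the lengths of its regular sequences. (For such
a sequence `R / (rs) ≠ 0`, so that its elements lie in the maximal ideal.) -/
noncomputable def depth : ℕ∞ :=
  ⨆ rs : {rs : List R // RingTheory.Sequence.IsRegular R rs}, (rs.1.length : ℕ∞)

/-- A local ring is Cohen-Macaulay if it is Noetherian and its depth is its Krull dimension. -/
def IsCohenMacaulay : Prop :=
  IsNoetherianRing R ∧ (depth R : WithBot ℕ∞) = ringKrullDim R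

/-- The (Cohen-Macaulay) type of a local ring with residue field `κ`: the dimension over `κ` of
`Ext^t_R(κ, R)`, where `t` is the depth. As `Ext^t_R(κ, R)` is annihilated by the maximal ideal,
this dimension is its length as an `R`-module. -/
noncomputable def cmType : ℕ∞ :=
  Module.length R (CategoryTheory.Abelian.Ext (ModuleCat.of R (IsLocalRing.ResidueField R))
    (ModuleCat.of R R) (depth R).toNat)

end LocalCM

/-! ### Semigroup rings -/

namespace AffineSemigroup

variable {r : ℕ}

/-- Evaluation of the monomials `t ^ s` at `t = 0`: the value is `1` if `s = 0`, and `0`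
otherwise. -/
noncomputable def monomialAtZero (K : Type*) [Field K] (S : AddSubmonoid (Fin r → ℕ)) :
    Multiplicative S →* K := by
  classical
  exact
  { toFun := fun s => if s.toAdd = 0 then 1 else 0
    map_one' := by simp
    map_mul' := by
      intro x y
      have h : x.toAdd + y.toAdd = 0 ↔ x.toAdd = 0 ∧ y.toAdd = 0 := by
        simp only [← Subtype.coe_inj, AddSubmonoid.coe_add, AddSubmonoid.coe_zero]
        exact add_eq_zero
      by_cases hx : x.toAdd = 0 <;> by_cases hy : y.toAdd = 0 <;> simp [h, hx, hy] }

/-- The `K`-algebra map from `K[S]` to `K` that takes the constant coefficient. -/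
noncomputable def constantCoeff (K : Type*) [Field K] (S : AddSubmonoid (Fin r → ℕ)) :
    AddMonoidAlgebra K S →ₐ[K] K :=
  AddMonoidAlgebra.lift K K S (monomialAtZero K S)

/-- The graded maximal ideal of the semigroup ring `K[S]`: the elements whose constant
coefficient vanishes, that is, the `K`-span of the monomials `t ^ s` with `s ≠ 0`. -/
noncomputable def gradedMaximalIdeal (K : Type*) [Field K] (S : AddSubmonoid (Fin r → ℕ)) :
    Ideal (AddMonoidAlgebra K S) :=
  RingHom.ker (constantCoeff K S)

instance gradedMaximalIdeal_isMaximal (K : Type*) [Field K] (S : AddSubmonoid (Fin r → ℕ)) :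
    (gradedMaximalIdeal K S).IsMaximal :=
  RingHom.ker_isMaximal_of_surjective (constantCoeff K S)
    (fun c => ⟨algebraMap K _ c, (constantCoeff K S).commutes c⟩)

theorem mem_gradedMaximalIdeal (K : Type*) [Field K] (S : AddSubmonoid (Fin r → ℕ))
    (f : AddMonoidAlgebra K S) : f ∈ gradedMaximalIdeal K S ↔ f.coeff 0 = 0 := by
  classical
  have h : constantCoeff K S f = f.coeff 0 := by
    rw [constantCoeff, AddMonoidAlgebra.lift_apply]
    simp [monomialAtZero, Finsupp.sum, eq_comm]
  rw [gradedMaximalIdeal, RingHom.mem_ker, h]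

/-- The localization of the semigroup ring `K[S]` at its graded maximal ideal. The semigroup ring
is positively graded, and its Cohen-Macaulay type is that of this local ring. -/
abbrev LocalSemigroupRing (K : Type*) [Field K] (S : AddSubmonoid (Fin r → ℕ)) : Type _ :=
  Localization.AtPrime (gradedMaximalIdeal K S)

/-- The generators `a, a + d, …, a + k d`. -/
def arithmeticSequence (a d : Fin 2 → ℕ) (k : ℕ) : Set (Fin 2 → ℕ) :=
  {v | ∃ i : ℕ, i ≤ k ∧ v = a + i • d}

/-- The affine semigroup `S_{a,d,k}` generated by `a, a + d, …, a + k d`. -/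
def arithmeticSemigroup (a d : Fin 2 → ℕ) (k : ℕ) : AddSubmonoid (Fin 2 → ℕ) :=
  AddSubmonoid.closure (arithmeticSequence a d k)

end AffineSemigroup

/-!
In the coordinates `n a + m d`, which are unique as `a` and `d` are independent, the semigroup
`S = S_{a,d,k}` is the set of all `(n, m)` with `0 ≤ m ≤ k n` (`mem_arithmeticSemigroup_iff`), so that
its semigroup ring is the `k`-th Veronese subring of a polynomial ring in two variables.

The cone of `S` has the two boundary rays through `a` and `a + k d`, and these two elements are the
extremal rays. An element `(n, m)` of `S` from which neither `(1, 0)` nor `(1, k)` can be subtracted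
satisfies `k (n - 1) < m < k`, so that `n ≤ 1`. The Apéry set therefore consists of `0` and of the
`a + i d` with `0 < i < k`, and the latter are its maximal elements. Subtracting `a + (a + k d)` from
`a + i d` gives `-(a + (k - i) d)`.

For the ring `K[S]`, write `x = t ^ a` and `y = t ^ (a + k d)`. The sequence `x, y` is regular
(`isWeaklyRegular_genMonomial`), the square of the graded maximal ideal `𝔪` lies in `(x, y)`, and
`𝔪 / (x, y)` has the `K`-basis of the monomials `t ^ (a + i d)` with `0 < i < k`. These facts pass to
the localization `R` at `𝔪`. Hence `R / (x, y)` is Artinian, so that both the depth and the dimension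
of `R` are `2`. Dimension shifting along the regular sequence (`LocalCM.ext_of_isWeaklyRegular`)
identifies `Ext^2(κ, R)` with the socle `Hom(κ, R / (x, y))`, and by `LocalCM.length_socle_quotient`
this socle is `𝔪 R / (x, y) R`, of length `k - 1`.
-/

/-! ### `Ext` modulo a regular sequence -/

namespace LocalCM

open CategoryTheory CategoryTheory.Abelian RingTheory.Sequence

universe u v

section Rees

variable {R : Type u} [CommRing R] [Small.{v} R]

/-- An element that is regular on `M` and kills `N` kills every homomorphism `N → M`. -/
theorem ext_zero_subsingleton {N M : ModuleCat.{v} R} {x : R}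
    (hN : x ∈ Module.annihilator R N) (hM : IsSMulRegular M x) :
    Subsingleton (Ext N M 0) := by
  have e : Ext N M 0 ≃ₗ[R] (N →ₗ[R] M) := Ext.linearEquiv₀ ≪≫ₗ ModuleCat.homLinearEquiv (S := R)
  refine e.toEquiv.subsingleton_congr.2 ⟨fun f g => LinearMap.ext fun n => hM ?_⟩
  simp only [← map_smul, Module.mem_annihilator.1 hN n, map_zero]

/-- The connecting homomorphism `Ext^n(N, M / xM) → Ext^{n+1}(N, M)` attached to the short exact
sequence `0 → M → M → M / xM → 0` given by multiplication by an `M`-regular element `x`. -/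
noncomputable def extConnecting (N : ModuleCat.{v} R) {M : ModuleCat.{v} R} {x : R}
    (hM : IsSMulRegular M x) (n : ℕ) :
    Ext N (ModuleCat.of R (QuotSMulTop x M)) n →ₗ[R] Ext N M (n + 1) :=
  Ext.postcompOfLinear hM.smulShortComplex_shortExact.extClass R N rfl

/-- The next map of the long exact sequence is multiplication by `x`, which vanishes on
`Ext^{n+1}(N, M)` because `x` kills `N`. -/
theorem extConnecting_surjective {N M : ModuleCat.{v} R} {x : R}
    (hN : x ∈ Module.annihilator R N) (hM : IsSMulRegular M x) (n : ℕ) :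
    Function.Surjective (extConnecting N hM n) := by
  intro e
  refine Ext.covariant_sequence_exact₁ N hM.smulShortComplex_shortExact e ?_ rfl
  have h : x • 𝟙 N = 0 := by
    simp [← ModuleCat.lsmul_eq_smul_id, Module.mem_annihilator_iff_lsmul_eq_zero.mp hN]
  have h' : x • e = (Ext.mk₀ (x • 𝟙 N)).comp e (zero_add _) := by simp [Ext.mk₀_smul]
  rw [h, Ext.mk₀_zero, Ext.zero_comp, Ext.smul_eq_comp_mk₀] at h'
  rw [ModuleCat.smulShortComplex_f_eq_smul_id]
  exact h'

theorem extConnecting_injective {N M : ModuleCat.{v} R} {x : R}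
    (hM : IsSMulRegular M x) (n : ℕ) [h : Subsingleton (Ext N M n)] :
    Function.Injective (extConnecting N hM n) := by
  rw [← LinearMap.ker_eq_bot, LinearMap.ker_eq_bot']
  intro e he
  obtain ⟨e', rfl⟩ := Ext.covariant_sequence_exact₃ N hM.smulShortComplex_shortExact e rfl he
  have h0 : e' = 0 := h.elim _ _
  rw [h0, Ext.zero_comp]
  rfl

/-- A regular sequence of length `n` on `M` that kills `N` shifts `Ext` by `n` degrees:
`Ext^i(N, M) = 0` for `i < n`, and `Ext^n(N, M) ≅ Hom(N, M / (rs) M)`. -/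
theorem ext_of_isWeaklyRegular (N : ModuleCat.{v} R) (rs : List R)
    (hN : ∀ x ∈ rs, x ∈ Module.annihilator R N) :
    ∀ M : ModuleCat.{v} R, IsWeaklyRegular M rs →
      (∀ i < rs.length, Subsingleton (Ext N M i)) ∧
      Nonempty (Ext N M rs.length ≃ₗ[R]
        (N →ₗ[R] (M ⧸ (Ideal.ofList rs • ⊤ : Submodule R M)))) := by
  induction rs with
  | nil =>
    refine fun M _ => ⟨by simp, ⟨Ext.linearEquiv₀ ≪≫ₗ ModuleCat.homLinearEquiv (S := R) ≪≫ₗ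
      LinearEquiv.congrRight (Submodule.quotEquivOfEqBot _ (by simp)).symm⟩⟩
  | cons x rs ih =>
    intro M hM
    rw [isWeaklyRegular_cons_iff] at hM
    obtain ⟨h₁, ⟨e⟩⟩ := ih (fun y hy => hN y (List.mem_cons_of_mem _ hy))
      (ModuleCat.of R (QuotSMulTop x M)) hM.2
    have hx := hN x List.mem_cons_self
    have h₂ : ∀ i < (x :: rs).length, Subsingleton (Ext N M i) := by
      rintro (_ | i) hi
      · exact ext_zero_subsingleton hx hM.1
      · have := h₁ i (by simpa using hi)
        exact (extConnecting_surjective hx hM.1 i).subsingleton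
    refine ⟨h₂, ⟨?_⟩⟩
    have := h₂ rs.length (by simp)
    exact (LinearEquiv.ofBijective _ ⟨extConnecting_injective hM.1 rs.length,
        extConnecting_surjective hx hM.1 rs.length⟩).symm ≪≫ₗ e ≪≫ₗ
      LinearEquiv.congrRight (Submodule.quotOfListConsSMulTopEquivQuotSMulTopInner M x rs).symm

end Rees

/-! ### The socle of a quotient of a local ring -/

section Socle

open IsLocalRing

variable {R : Type u} [CommRing R] [IsLocalRing R]

/-- If `𝔪² ⊆ I`, and `𝔪` is generated modulo `I` by elements `v i` that are linearly independent
over the residue field, then the `v i` form a basis of the socle `Hom(κ, R / I)` of `R / I`. -/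
theorem length_socle_quotient {ι : Type*} [Fintype ι] [Nonempty ι] {I : Ideal R} {v : ι → R}
    (hI : maximalIdeal R * maximalIdeal R ≤ I)
    (hspan : maximalIdeal R = I ⊔ Ideal.span (Set.range v))
    (hindep : ∀ c : ι → R, ∑ i, c i * v i ∈ I → ∀ i, c i ∈ maximalIdeal R) :
    Module.length R (ResidueField R →ₗ[R] R ⧸ I) = Fintype.card ι := by
  classical
  have hv : ∀ i, v i ∈ maximalIdeal R := fun i => by
    rw [hspan]; exact Ideal.mem_sup_right (Ideal.subset_span ⟨i, rfl⟩)
  -- `ev` identifies `Hom(κ, R / I)` with the socle, and `Ψ` is the map `R ^ ι → R / I` given by `v`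
  let ev : (ResidueField R →ₗ[R] R ⧸ I) →ₗ[R] R ⧸ I := LinearMap.applyₗ (1 : ResidueField R)
  let Ψ : (ι → R) →ₗ[R] R ⧸ I := I.mkQ ∘ₗ Fintype.linearCombination R v
  have hΨ : ∀ c, Ψ c = Ideal.Quotient.mk I (∑ i, c i * v i) := fun c => by
    simp [Ψ, Fintype.linearCombination_apply]
  have hker : LinearMap.ker Ψ = Submodule.pi Set.univ fun _ => maximalIdeal R := by
    ext c
    rw [LinearMap.mem_ker, hΨ, Ideal.Quotient.eq_zero_iff_mem, Submodule.mem_pi]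
    refine ⟨fun h i _ => hindep c h i, fun h => I.sum_mem fun i _ => hI ?_⟩
    exact Ideal.mul_mem_mul (h i trivial) (hv i)
  have hinj : LinearMap.ker ev = ⊥ := by
    rw [LinearMap.ker_eq_bot]
    intro f g h
    refine LinearMap.ext fun z => ?_
    obtain ⟨r, rfl⟩ := IsLocalRing.residue_surjective z
    have : residue R r = r • (1 : ResidueField R) := by rw [Algebra.smul_def, mul_one]; rfl
    rw [this, map_smul, map_smul]
    exact congrArg _ h
  have hrange : LinearMap.range ev = LinearMap.range Ψ := by
    ext z
    constructor
    · rintro ⟨f, rfl⟩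
      obtain ⟨r, hr⟩ := Ideal.Quotient.mk_surjective (f 1)
      have hmr : ∀ t ∈ maximalIdeal R, t * r ∈ I := fun t ht => by
        rw [← Ideal.Quotient.eq_zero_iff_mem, map_mul, hr]
        change t • f 1 = 0
        rw [← map_smul, Algebra.smul_def, mul_one, ResidueField.algebraMap_eq,
          (residue_eq_zero_iff t).2 ht, map_zero]
      -- if `r` were a unit, then `v i` would lie in `I`, against the independence of `v`
      have hrm : r ∈ maximalIdeal R := by
        obtain ⟨i⟩ := ‹Nonempty ι›
        have := hindep (Pi.single i r) (by
          simpa [Pi.single_apply, mul_comm] using hmr _ (hv i)) i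
        simpa using this
      rw [hspan, Submodule.mem_sup] at hrm
      obtain ⟨y, hy, z, hz, rfl⟩ := hrm
      obtain ⟨c, rfl⟩ := (Ideal.mem_span_range_iff_exists_fun).1 hz
      refine ⟨c, ?_⟩
      change _ = f 1
      rw [hΨ, ← hr, map_add, Ideal.Quotient.eq_zero_iff_mem.2 hy, zero_add]
    · rintro ⟨c, rfl⟩
      refine ⟨Submodule.liftQ _ (LinearMap.toSpanSingleton R (R ⧸ I) (Ψ c)) ?_, ?_⟩
      · intro t ht
        rw [LinearMap.mem_ker, LinearMap.toSpanSingleton_apply, ← map_smul, ← LinearMap.mem_ker,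
          hker]
        exact fun i _ => Ideal.mul_mem_right _ _ ht
      · change (1 : R) • Ψ c = Ψ c
        exact one_smul _ _
  have e : (ResidueField R →ₗ[R] R ⧸ I) ≃ₗ[R] (ι → ResidueField R) :=
    LinearEquiv.ofInjective ev (LinearMap.ker_eq_bot.1 hinj) ≪≫ₗ
      LinearEquiv.ofEq _ _ hrange ≪≫ₗ Ψ.quotKerEquivRange.symm ≪≫ₗ
      Submodule.quotEquivOfEq _ _ hker ≪≫ₗ Submodule.quotientPi fun _ => maximalIdeal R
  have h1 : Module.length R (ResidueField R) = 1 := by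
    rw [Module.length_eq_one_iff]
    exact isSimpleModule_iff_isCoatom.2 (maximalIdeal.isMaximal R).out
  rw [e.length_eq, Module.length_pi, h1, mul_one]
  simp

end Socle

end LocalCM

/-! ### Depth, dimension and type from a regular sequence -/

namespace LocalCM

open RingTheory.Sequence IsLocalRing

universe u

section Depth

variable {R : Type u} [CommRing R] [IsLocalRing R] [IsNoetherianRing R]

/-- A regular sequence whose ideal contains a power of the maximal ideal has the dimension of the
ring as its length: the quotient is Artinian. -/
theorem ringKrullDim_eq_length {rs : List R} (hrs : IsRegular R rs) {n : ℕ}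
    (h : maximalIdeal R ^ n ≤ Ideal.ofList rs) : ringKrullDim R = rs.length := by
  have hne : Ideal.ofList rs ≠ ⊤ := fun h' => hrs.2 (by rw [h']; simp)
  have : Nontrivial (R ⧸ Ideal.ofList rs) := Ideal.Quotient.nontrivial_iff.2 hne
  have hsurj := Ideal.Quotient.mk_surjective (I := Ideal.ofList rs)
  have := IsLocalRing.of_surjective' _ hsurj
  have hart : IsArtinianRing (R ⧸ Ideal.ofList rs) := by
    rw [isArtinianRing_iff_isNilpotent_maximalIdeal]
    refine ⟨n, ?_⟩
    rw [← IsLocalRing.map_maximalIdeal_of_surjective _ hsurj, ← Ideal.map_pow, Ideal.zero_eq_bot,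
      Ideal.map_eq_bot_iff_le_ker, Ideal.mk_ker]
    exact h
  rw [← ringKrullDim_add_length_eq_ringKrullDim_of_isRegular rs hrs,
    ringKrullDimZero_iff_ringKrullDim_eq_zero.1 inferInstance, zero_add]

/-- No regular sequence is longer than the dimension, so one of that length computes the depth. -/
theorem depth_eq_length {rs : List R} (hrs : IsRegular R rs)
    (h : ringKrullDim R = rs.length) : depth R = rs.length := by
  refine le_antisymm (iSup_le fun ss => ?_) (le_iSup_of_le ⟨rs, hrs⟩ le_rfl)
  have h1 := ringKrullDim_add_length_eq_ringKrullDim_of_isRegular ss.1 ss.2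
  have hne : Ideal.ofList ss.1 ≠ ⊤ := fun h' => ss.2.2 (by rw [h']; simp)
  have : Nontrivial (R ⧸ Ideal.ofList ss.1) := Ideal.Quotient.nontrivial_iff.2 hne
  have h2 : (0 : WithBot ℕ∞) ≤ ringKrullDim (R ⧸ Ideal.ofList ss.1) :=
    ringKrullDim_nonneg_of_nontrivial
  have h3 : ((ss.1.length : ℕ) : WithBot ℕ∞) ≤ (rs.length : WithBot ℕ∞) := by
    rw [← h, ← h1]
    exact le_add_of_nonneg_left h2
  exact_mod_cast h3

theorem isCohenMacaulay_of_isRegular {rs : List R} (hrs : IsRegular R rs) {n : ℕ}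
    (h : maximalIdeal R ^ n ≤ Ideal.ofList rs) : IsCohenMacaulay R := by
  have hdim := ringKrullDim_eq_length hrs h
  exact ⟨inferInstance, by rw [hdim, depth_eq_length hrs hdim]; rfl⟩

/-- The type of a local ring is the dimension of the socle of its quotient by a maximal regular
sequence; here the square of the maximal ideal is assumed to vanish in that quotient. -/
theorem cmType_eq_card {rs : List R} (hrs : IsRegular R rs) {ι : Type*} [Fintype ι] [Nonempty ι]
    {v : ι → R} (h : maximalIdeal R * maximalIdeal R ≤ Ideal.ofList rs)
    (hspan : maximalIdeal R = Ideal.ofList rs ⊔ Ideal.span (Set.range v))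
    (hindep : ∀ c : ι → R, ∑ i, c i * v i ∈ Ideal.ofList rs → ∀ i, c i ∈ maximalIdeal R) :
    cmType R = Fintype.card ι := by
  rw [← pow_two] at h
  have hd : (depth R).toNat = rs.length := by
    rw [depth_eq_length hrs (ringKrullDim_eq_length hrs h), ENat.toNat_natCast]
  have hann : ∀ x ∈ rs, x ∈ Module.annihilator R (ModuleCat.of R (ResidueField R)) := by
    intro x hx
    have hxm : x ∈ maximalIdeal R := by
      rw [hspan]
      exact Ideal.mem_sup_left (Ideal.subset_span hx)
    rw [Module.mem_annihilator]
    intro z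
    change x • (z : ResidueField R) = 0
    rw [Algebra.smul_def, ResidueField.algebraMap_eq, (residue_eq_zero_iff x).2 hxm, zero_mul]
  obtain ⟨-, ⟨e⟩⟩ := ext_of_isWeaklyRegular (ModuleCat.of R (ResidueField R)) rs hann
    (ModuleCat.of R R) hrs.1
  rw [cmType, hd, e.length_eq, ← length_socle_quotient (pow_two (maximalIdeal R) ▸ h) hspan hindep]
  exact (LinearEquiv.congrRight (Submodule.quotEquivOfEq _ _ (by simp))).length_eq

end Depth

/-! ### Independence modulo an ideal after localization -/

section Localization

variable {A : Type*} [CommRing A] (p : Ideal A) [p.IsPrime]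

/-- If a relation `∑ f i * v i ∈ I` forces all `f i` into the prime `p`, then the analogous
statement holds over the localization at `p`: clear denominators. -/
theorem mem_maximalIdeal_of_sum_mem_map {ι : Type*} [Fintype ι] {I : Ideal A} {v : ι → A}
    (h : ∀ f : ι → A, ∑ i, f i * v i ∈ I → ∀ i, f i ∈ p) (c : ι → Localization.AtPrime p)
    (hc : ∑ i, c i * algebraMap A (Localization.AtPrime p) (v i) ∈ I.map (algebraMap A _)) (i : ι) :
    c i ∈ maximalIdeal (Localization.AtPrime p) := by
  obtain ⟨b, hb⟩ := IsLocalization.exist_integer_multiples_of_finite p.primeCompl c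
  choose f hf using hb
  have h1 : algebraMap A (Localization.AtPrime p) (∑ i, f i * v i) ∈ I.map (algebraMap A _) := by
    have : algebraMap A (Localization.AtPrime p) (∑ i, f i * v i) =
        algebraMap A _ (b : A) * ∑ i, c i * algebraMap A (Localization.AtPrime p) (v i) := by
      rw [map_sum, Finset.mul_sum]
      refine Finset.sum_congr rfl fun i _ => ?_
      rw [map_mul, hf, Algebra.smul_def, mul_assoc]
    rw [this]
    exact Ideal.mul_mem_left _ _ hc
  obtain ⟨u, hu, hui⟩ := (IsLocalization.algebraMap_mem_map_algebraMap_iff p.primeCompl _ _ _).1 h1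
  have h2 : u * f i ∈ p := h (fun i => u * f i) (by
    simpa only [Finset.mul_sum, mul_assoc] using hui) i
  have h3 : f i ∈ p := (Ideal.IsPrime.mem_or_mem ‹_› h2).resolve_left hu
  have h4 := (IsLocalization.AtPrime.to_map_mem_maximal_iff (Localization.AtPrime p) p _).2 h3
  rw [hf, Algebra.smul_def] at h4
  refine (Ideal.IsPrime.mem_or_mem inferInstance h4).resolve_left fun h5 => b.2 ?_
  exact (IsLocalization.AtPrime.to_map_mem_maximal_iff (Localization.AtPrime p) p _).1 h5

end Localization

end LocalCM

/-! ### Coordinates on `S_{a,d,k}` -/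

namespace AffineSemigroup

variable {a d : Fin 2 → ℕ} {k : ℕ}

theorem det_ne_zero (had : LinearIndependent ℚ ![toRat a, toRat d]) :
    (a 0 : ℤ) * d 1 - a 1 * d 0 ≠ 0 := by
  rw [LinearIndependent.pair_iff] at had
  intro h
  have hq : (a 0 : ℚ) * d 1 - a 1 * d 0 = 0 := by exact_mod_cast h
  have h1 := had (d 1) (-(a 1)) (by
    ext i; fin_cases i <;> simp [toRat] <;> linarith)
  have h2 := had (d 0) (-(a 0)) (by
    ext i; fin_cases i <;> simp [toRat] <;> linarith)
  have h3 := had 1 0 (by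
    ext i; fin_cases i <;> simp [toRat] <;> [simpa using h2.2; simpa using h1.2])
  exact one_ne_zero h3.1

theorem coord_unique (had : (a 0 : ℤ) * d 1 - a 1 * d 0 ≠ 0) {n m n' m' : ℕ}
    (h : n • a + m • d = n' • a + m' • d) : n = n' ∧ m = m' := by
  have h0 : (n * a 0 + m * d 0 : ℤ) = n' * a 0 + m' * d 0 := by
    exact_mod_cast congrFun h 0
  have h1 : (n * a 1 + m * d 1 : ℤ) = n' * a 1 + m' * d 1 := by
    exact_mod_cast congrFun h 1
  constructor
  · have : ((n : ℤ) - n') * (a 0 * d 1 - a 1 * d 0) = 0 := by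
      linear_combination d 1 * h0 - d 0 * h1
    have := (mul_eq_zero.1 this).resolve_right had
    omega
  · have : ((m : ℤ) - m') * (a 0 * d 1 - a 1 * d 0) = 0 := by
      linear_combination a 0 * h1 - a 1 * h0
    have := (mul_eq_zero.1 this).resolve_right had
    omega

/-- In the coordinates `n a + m d`, the semigroup `S_{a,d,k}` is the set of all pairs of natural
numbers `n`, `m` with `m ≤ k n`. -/
theorem mem_arithmeticSemigroup_iff {s : Fin 2 → ℕ} :
    s ∈ arithmeticSemigroup a d k ↔ ∃ n m : ℕ, m ≤ k * n ∧ s = n • a + m • d := by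
  constructor
  · intro h
    induction h using AddSubmonoid.closure_induction with
    | mem x hx =>
      obtain ⟨i, hi, rfl⟩ := hx
      exact ⟨1, i, by simpa using hi, by simp⟩
    | zero => exact ⟨0, 0, by simp, by simp⟩
    | add x y _ _ hx hy =>
      obtain ⟨n, m, h, rfl⟩ := hx
      obtain ⟨n', m', h', rfl⟩ := hy
      exact ⟨n + n', m + m', by rw [mul_add]; exact add_le_add h h',
        by rw [add_smul, add_smul]; abel⟩
  · rintro ⟨n, m, h, rfl⟩
    induction n generalizing m with
    | zero =>
      obtain rfl : m = 0 := by simpa using h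
      simp
    | succ n ih =>
      -- split off `a + i d` with `i` as large as possible
      have h1 := ih (m - min m k) (by rw [mul_add] at h; omega)
      have h2 : a + min m k • d ∈ arithmeticSemigroup a d k :=
        AddSubmonoid.subset_closure ⟨min m k, min_le_right _ _, rfl⟩
      convert add_mem h1 h2 using 1
      obtain ⟨j, hj⟩ : ∃ j, m = j + min m k := ⟨m - min m k, by omega⟩
      rw [show m - min m k = j by omega]
      conv_lhs => rw [hj]
      rw [add_smul, add_smul, one_smul]; abel

theorem add_smul_mem {i : ℕ} (hi : i ≤ k) : a + i • d ∈ arithmeticSemigroup a d k :=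
  AddSubmonoid.subset_closure ⟨i, hi, rfl⟩

/-- Since `k (n a + m d) = (k n - m) a + m (a + k d)`, the elements `a` and `a + k d` witness that
`S_{a,d,k}` is simplicial. -/
theorem isSimplicial_arithmeticSemigroup (had : LinearIndependent ℚ ![toRat a, toRat d])
    (hk : 0 < k) : IsSimplicial (arithmeticSemigroup a d k) := by
  refine ⟨![a, a + k • d], ?_, ?_, ?_⟩
  · rw [Fin.forall_fin_two]
    exact ⟨by simpa using add_smul_mem (a := a) (d := d) (Nat.zero_le k), add_smul_mem le_rfl⟩
  · have hk' : (k : ℚ) ≠ 0 := by exact_mod_cast hk.ne'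
    have heq : (fun j => toRat ((![a, a + k • d] : Fin 2 → Fin 2 → ℕ) j)) =
        ![toRat a, toRat a + (k : ℚ) • toRat d] := by
      ext j i; fin_cases j <;> simp [toRat]
    rw [heq]
    rw [LinearIndependent.pair_iff] at had ⊢
    intro s t h
    obtain ⟨h1, h2⟩ := had (s + t) (t * k) (by rw [← h]; module)
    have ht : t = 0 := (mul_eq_zero.1 h2).resolve_right hk'
    exact ⟨by simpa [ht] using h1, ht⟩
  · intro s hs
    obtain ⟨n, m, h, rfl⟩ := mem_arithmeticSemigroup_iff.1 hs
    obtain ⟨j, hj⟩ := Nat.exists_eq_add_of_le h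
    refine ⟨k, hk.ne', ![j, m], ?_⟩
    rw [Fin.sum_univ_two]
    simp only [Matrix.cons_val_zero, Matrix.cons_val_one, smul_add, smul_smul, hj]
    rw [add_smul, mul_comm k m]
    abel

/-- The truncated subtractions are exact because of the first two conditions. -/
theorem sle_iff (had : (a 0 : ℤ) * d 1 - a 1 * d 0 ≠ 0) {n m n' m' : ℕ} :
    SLE (arithmeticSemigroup a d k) (n • a + m • d) (n' • a + m' • d) ↔
      n ≤ n' ∧ m ≤ m' ∧ m' - m ≤ k * (n' - n) := by
  constructor
  · rintro ⟨s, hs, h⟩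
    obtain ⟨p, q, hpq, rfl⟩ := mem_arithmeticSemigroup_iff.1 hs
    obtain ⟨rfl, rfl⟩ := coord_unique had (n := n + p) (m := m + q) (by
      rw [← h, add_smul, add_smul]; abel)
    exact ⟨by omega, by omega, by simpa using hpq⟩
  · rintro ⟨h1, h2, h3⟩
    obtain ⟨p, rfl⟩ := Nat.exists_eq_add_of_le h1
    obtain ⟨q, rfl⟩ := Nat.exists_eq_add_of_le h2
    refine ⟨p • a + q • d, mem_arithmeticSemigroup_iff.2 ⟨p, q, by simpa using h3, rfl⟩, ?_⟩
    rw [add_smul, add_smul]; abel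

/-! ### The cone and its extremal rays -/

theorem toReal_add_smul (n m : ℕ) :
    toReal (n • a + m • d) = (n : ℝ) • toReal a + (m : ℝ) • toReal d := by
  ext i; simp [toReal]

theorem real_coord_unique (had : (a 0 : ℤ) * d 1 - a 1 * d 0 ≠ 0) {p q p' q' : ℝ}
    (h : p • toReal a + q • toReal d = p' • toReal a + q' • toReal d) : p = p' ∧ q = q' := by
  have had' : (a 0 : ℝ) * d 1 - a 1 * d 0 ≠ 0 := by exact_mod_cast had
  have h0 : p * a 0 + q * d 0 = p' * a 0 + q' * d 0 := congrFun h 0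
  have h1 : p * a 1 + q * d 1 = p' * a 1 + q' * d 1 := congrFun h 1
  constructor
  · have : (p - p') * (a 0 * d 1 - a 1 * d 0) = 0 := by
      linear_combination d 1 * h0 - d 0 * h1
    exact sub_eq_zero.1 ((mul_eq_zero.1 this).resolve_right had')
  · have : (q - q') * (a 0 * d 1 - a 1 * d 0) = 0 := by
      linear_combination a 0 * h1 - a 1 * h0
    exact sub_eq_zero.1 ((mul_eq_zero.1 this).resolve_right had')

theorem mem_cone_arithmeticSemigroup_iff (hk : 0 < k) {x : Fin 2 → ℝ} :
    x ∈ cone (arithmeticSemigroup a d k) ↔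
      ∃ p q : ℝ, 0 ≤ q ∧ q ≤ k * p ∧ x = p • toReal a + q • toReal d := by
  constructor
  · intro h
    induction h using Submodule.span_induction with
    | mem x hx =>
      obtain ⟨s, hs, rfl⟩ := hx
      obtain ⟨n, m, h, rfl⟩ := mem_arithmeticSemigroup_iff.1 hs
      exact ⟨n, m, m.cast_nonneg, by exact_mod_cast h, toReal_add_smul n m⟩
    | zero => exact ⟨0, 0, le_rfl, by simp, by simp⟩
    | add x y _ _ hx hy =>
      obtain ⟨p, q, h, h', rfl⟩ := hx
      obtain ⟨p', q', h₁, h₁', rfl⟩ := hy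
      exact ⟨p + p', q + q', by positivity, by linarith, by module⟩
    | smul r x _ hx =>
      obtain ⟨p, q, h, h', rfl⟩ := hx
      refine ⟨r * p, r * q, mul_nonneg r.2 h, ?_, ?_⟩
      · have := mul_le_mul_of_nonneg_left h' r.2
        linarith
      · change (r : ℝ) • (p • toReal a + q • toReal d) = _
        module
  · rintro ⟨p, q, h, h', rfl⟩
    have hk' : (0 : ℝ) < k := by exact_mod_cast hk
    have key : ∀ r : ℝ, 0 ≤ r → ∀ s ∈ arithmeticSemigroup a d k,
        r • toReal s ∈ cone (arithmeticSemigroup a d k) := fun r hr s hs =>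
      Submodule.smul_mem _ (⟨r, hr⟩ : {c : ℝ // 0 ≤ c}) (Submodule.subset_span ⟨s, hs, rfl⟩)
    have h1 := key (p - q / k) (by rw [sub_nonneg, div_le_iff₀ hk']; linarith) _
      (add_smul_mem (a := a) (d := d) (Nat.zero_le k))
    have h2 := key (q / k) (by positivity) _ (add_smul_mem (a := a) (d := d) (le_refl k))
    have h3 := add_mem h1 h2
    have e (i : ℕ) : toReal (a + i • d) = toReal a + (i : ℝ) • toReal d := by
      have := toReal_add_smul (a := a) (d := d) 1 i
      simpa using this
    rw [e, e] at h3
    convert h3 using 1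
    have : q = q / k * k := by field_simp
    ext i
    simp only [Pi.add_apply, Pi.smul_apply, smul_eq_mul, Nat.cast_zero]
    linear_combination (toReal d i) * this

/-- The rays through `a` and `a + k d` are the zero loci on the cone of the nonnegative functionals
`q` and `k p - q`, where `p` and `q` are the coordinates with respect to `a` and `d`. -/
theorem isExtreme_ray (had : (a 0 : ℤ) * d 1 - a 1 * d 0 ≠ 0) (hk : 0 < k) {i : ℕ}
    (hi : i = 0 ∨ i = k) :
    IsExtreme ℝ (cone (arithmeticSemigroup a d k) : Set (Fin 2 → ℝ)) (ray (a + i • d)) := by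
  have e : toReal (a + i • d) = toReal a + (i : ℝ) • toReal d := by
    simpa using toReal_add_smul (a := a) (d := d) 1 i
  have hik : (i : ℝ) ≤ k := by rcases hi with rfl | rfl <;> simp
  have hk' : (0 : ℝ) < k := by exact_mod_cast hk
  refine ⟨?_, ?_⟩
  · rintro x ⟨t, ht, rfl⟩
    refine (mem_cone_arithmeticSemigroup_iff hk).2 ⟨t, t * i, by positivity, ?_, ?_⟩
    · rw [mul_comm]; exact mul_le_mul_of_nonneg_right hik ht
    · rw [e]; module
  · rintro x hx y hy z ⟨t, ht, rfl⟩ ⟨u, v, hu, hv, huv, hz⟩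
    obtain ⟨p, q, h1, h2, rfl⟩ := (mem_cone_arithmeticSemigroup_iff hk).1 hx
    obtain ⟨p', q', h1', h2', rfl⟩ := (mem_cone_arithmeticSemigroup_iff hk).1 hy
    obtain ⟨hp, hq⟩ := real_coord_unique had (p := u * p + v * p') (q := u * q + v * q') (p' := t)
      (q' := t * i) (by
        rw [e] at hz
        calc
          _ = u • (p • toReal a + q • toReal d) + v • (p' • toReal a + q' • toReal d) := by module
          _ = t • (toReal a + (i : ℝ) • toReal d) := hz
          _ = _ := by module)
    have hpn : 0 ≤ p := by
      by_contra! hneg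
      nlinarith
    refine ⟨p, hpn, ?_⟩
    suffices q = p * i by rw [e, this]; module
    rcases hi with rfl | rfl
    · have : u * q + v * q' = 0 := by simpa using hq
      have := mul_nonneg hu.le h1
      have := mul_nonneg hv.le h1'
      have : u * q = 0 := by linarith
      simpa using (mul_eq_zero.1 this).resolve_left hu.ne'
    · have := mul_nonneg hu.le (sub_nonneg.2 h2)
      have := mul_nonneg hv.le (sub_nonneg.2 h2')
      have : u * (i * p - q) = 0 := by
        rw [← hp] at hq
        linarith
      have := (mul_eq_zero.1 this).resolve_left hu.ne'
      linarith

theorem extremalRays_arithmeticSemigroup (had : (a 0 : ℤ) * d 1 - a 1 * d 0 ≠ 0) (hk : 0 < k) :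
    extremalRays (arithmeticSemigroup a d k) = {a, a + k • d} := by
  have e (i : ℕ) : toReal (a + i • d) = toReal a + (i : ℝ) • toReal d := by
    simpa using toReal_add_smul (a := a) (d := d) 1 i
  have hne (i : ℕ) : a + i • d ≠ 0 := fun h => by
    have := (coord_unique had (n := 1) (m := i) (n' := 0) (m' := 0) (by simpa using h)).1
    omega
  have hk' : (0 : ℝ) < k := by exact_mod_cast hk
  have hgen : ∀ i, i = 0 ∨ i = k → a + i • d ∈ extremalRays (arithmeticSemigroup a d k) := by
    intro i hi
    have hik : i ≤ k := by omega
    refine ⟨add_smul_mem hik, hne i, isExtreme_ray had hk hi, ?_⟩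
    rintro s hs hs0 ⟨t, ht, hst⟩
    obtain ⟨n, m, h, rfl⟩ := mem_arithmeticSemigroup_iff.1 hs
    rw [toReal_add_smul, e] at hst
    obtain ⟨rfl, hm⟩ := real_coord_unique had (p := n) (q := m) (p' := t) (q' := t * i)
      (by rw [hst]; module)
    obtain rfl : m = n * i := by exact_mod_cast hm
    have hn : n ≠ 0 := by rintro rfl; simp at hs0
    obtain ⟨n, rfl⟩ := Nat.exists_eq_succ_of_ne_zero hn
    have : n.succ • a + (n.succ * i) • d = (a + i • d) + n • (a + i • d) := by
      rw [mul_smul, ← smul_add, succ_nsmul']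
    rw [this]
    exact le_self_add
  refine Set.Subset.antisymm ?_ ?_
  · rintro x ⟨hx, hx0, hext, hmin⟩
    obtain ⟨n, m, h, rfl⟩ := mem_arithmeticSemigroup_iff.1 hx
    have hn : n ≠ 0 := by
      rintro rfl
      obtain rfl : m = 0 := by simpa using h
      simp at hx0
    obtain ⟨n, rfl⟩ := Nat.exists_eq_succ_of_ne_zero hn
    -- an element `n a + m d` with `0 < m < k n` lies inside a segment with ends on the two
    -- boundary rays of the cone
    have hm : m = n.succ * 0 ∨ m = n.succ * k := by
      have hz : toReal (n.succ • a + m • d) ∈ ray (n.succ • a + m • d) :=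
        ⟨1, zero_le_one, by simp⟩
      have hm' : (m : ℝ) ≤ k * (n.succ : ℕ) := by exact_mod_cast h
      have hmem : (2 * ((n.succ : ℕ) - m / k : ℝ)) • toReal a ∈ ray (n.succ • a + m • d) := by
        refine hext.2 (x := (2 * ((n.succ : ℕ) - m / k : ℝ)) • toReal a)
          (y := (2 * (m / k : ℝ)) • (toReal a + (k : ℝ) • toReal d)) ?_ ?_ hz
          ⟨1/2, 1/2, by norm_num, by norm_num, by norm_num, ?_⟩
        · refine (mem_cone_arithmeticSemigroup_iff hk).2 ⟨_, 0, le_rfl, ?_, by simp; rfl⟩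
          have : (0 : ℝ) ≤ (n.succ : ℕ) - (m : ℝ) / k := by
            rw [sub_nonneg, div_le_iff₀ hk']; linarith
          push_cast at this ⊢
          exact mul_nonneg hk'.le (mul_nonneg zero_le_two this)
        · refine (mem_cone_arithmeticSemigroup_iff hk).2
            ⟨2 * (m / k : ℝ), 2 * (m / k : ℝ) * k, by positivity, by rw [mul_comm], by module⟩
        · rw [toReal_add_smul]
          have : (m : ℝ) = m / k * k := by field_simp
          ext i
          simp only [Pi.add_apply, Pi.smul_apply, smul_eq_mul]
          linear_combination -(toReal d i) * this
      obtain ⟨t, ht, htt⟩ := hmem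
      rw [toReal_add_smul] at htt
      obtain ⟨h1, h2⟩ := real_coord_unique had (p := 2 * ((n.succ : ℕ) - m / k : ℝ)) (q := 0)
        (p' := t * (n.succ : ℕ)) (q' := t * m) (by rw [zero_smul, add_zero, htt]; module)
      rcases mul_eq_zero.1 h2.symm with h0 | h0
      · right
        rw [h0, zero_mul] at h1
        have : (m : ℝ) = (n.succ : ℕ) * k := by
          field_simp at h1
          linarith
        exact_mod_cast this
      · left
        simpa using h0
    have key : ∀ i, i = 0 ∨ i = k → m = n.succ * i → n.succ • a + m • d = a + i • d := by
      rintro i hi rfl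
      have h1 : n.succ • a + (n.succ * i) • d = n.succ • (a + i • d) := by
        rw [mul_smul, ← smul_add]
      have hle := hmin (a + i • d) (hgen i hi).1 (hne i)
        ⟨1 / (n.succ : ℕ), by positivity, by
          rw [h1]
          ext j
          simp only [toReal, Pi.smul_apply, smul_eq_mul, Nat.cast_mul]
          field_simp⟩
      refine le_antisymm hle ?_
      rw [h1, succ_nsmul']
      exact le_self_add
    rcases hm with hm | hm
    · left; simpa using key 0 (Or.inl rfl) hm
    · right; exact key k (Or.inr rfl) hm
  · rintro x (rfl | rfl)
    · simpa using hgen 0 (Or.inl rfl)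
    · exact hgen k (Or.inr rfl)

/-! ### Apéry set and quasi-Frobenius elements -/

theorem apery_arithmeticSemigroup (had : (a 0 : ℤ) * d 1 - a 1 * d 0 ≠ 0) (hk : 0 < k) :
    apery (arithmeticSemigroup a d k) (extremalRays (arithmeticSemigroup a d k)) =
      {b | b = 0 ∨ ∃ i : ℕ, 1 ≤ i ∧ i ≤ k - 1 ∧ b = a + i • d} := by
  have h0 (n m : ℕ) := sle_iff (k := k) had (n := 1) (m := 0) (n' := n) (m' := m)
  have h1 (n m : ℕ) := sle_iff (k := k) had (n := 1) (m := k) (n' := n) (m' := m)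
  simp only [one_smul, zero_smul, add_zero] at h0 h1
  rw [extremalRays_arithmeticSemigroup had hk]
  ext b
  simp only [apery, Set.mem_ofPred_eq, Set.mem_insert_iff, Set.mem_singleton_iff, forall_eq_or_imp,
    forall_eq]
  constructor
  · rintro ⟨hb, h2, h3⟩
    obtain ⟨n, m, h, rfl⟩ := mem_arithmeticSemigroup_iff.1 hb
    rw [h0] at h2
    rw [h1] at h3
    obtain _ | _ | n := n
    · left
      obtain rfl : m = 0 := by simpa using h
      simp
    · right
      refine ⟨m, ?_, ?_, by simp⟩ <;> simp at h h2 h3 <;> omega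
    · exfalso
      simp only [mul_add, mul_one, Nat.add_sub_cancel] at h h2 h3
      omega
  · rintro (rfl | ⟨i, hi, hik, rfl⟩)
    · have h0' := h0 0 0
      have h1' := h1 0 0
      simp only [zero_smul, add_zero] at h0' h1'
      exact ⟨zero_mem _, by rw [h0']; omega, by rw [h1']; omega⟩
    · have h0' := h0 1 i
      have h1' := h1 1 i
      simp only [one_smul] at h0' h1'
      exact ⟨add_smul_mem (by omega), by rw [h0']; simp; omega, by rw [h1']; simp; omega⟩

theorem maxApery_arithmeticSemigroup (had : (a 0 : ℤ) * d 1 - a 1 * d 0 ≠ 0) (hk : 2 ≤ k) :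
    maxApery (arithmeticSemigroup a d k) (extremalRays (arithmeticSemigroup a d k)) =
      {b | ∃ i : ℕ, 1 ≤ i ∧ i ≤ k - 1 ∧ b = a + i • d} := by
  have hne (i : ℕ) : a + i • d ≠ 0 := fun h => by
    have := (coord_unique had (n := 1) (m := i) (n' := 0) (m' := 0) (by simpa using h)).1
    omega
  ext b
  simp only [maxApery, apery_arithmeticSemigroup had (by omega : 0 < k), Set.mem_ofPred_eq]
  constructor
  · rintro ⟨rfl | hb, hmax⟩
    · refine absurd (hmax (a + 1 • d) (Or.inr ⟨1, le_rfl, by omega, rfl⟩)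
        ⟨_, add_smul_mem (by omega), zero_add _⟩) (hne 1)
    · exact hb
  · rintro ⟨i, hi, hik, rfl⟩
    refine ⟨Or.inr ⟨i, hi, hik, rfl⟩, ?_⟩
    rintro c (rfl | ⟨j, hj, hjk, rfl⟩) hle
    · obtain ⟨s, -, hs⟩ := hle
      exact absurd (add_eq_zero.1 hs).1 (hne i)
    · have := sle_iff (k := k) had (n := 1) (m := i) (n' := 1) (m' := j)
      rw [one_smul] at this
      obtain rfl : i = j := by
        have := this.1 hle
        simp at this
        omega
      rfl

theorem QF_arithmeticSemigroup (had : (a 0 : ℤ) * d 1 - a 1 * d 0 ≠ 0) (hk : 2 ≤ k) :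
    QF (arithmeticSemigroup a d k) =
      {f | ∃ i : ℕ, 1 ≤ i ∧ i ≤ k - 1 ∧ f = -(toInt (a + i • d))} := by
  have hne : a ≠ a + k • d := fun h => by
    have := (coord_unique had (n := 1) (m := 0) (n' := 1) (m' := k) (by simpa using h)).2
    omega
  -- `(a + i d) - a - (a + k d) = -(a + (k - i) d)`
  have key : ∀ i j, i + j = k →
      toInt (a + i • d) - (toInt a + toInt (a + k • d)) = -(toInt (a + j • d)) := by
    rintro i j rfl
    ext l
    simp [toInt]
    ring
  unfold QF
  rw [maxApery_arithmeticSemigroup had hk, extremalRays_arithmeticSemigroup had (by omega),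
    finsum_mem_pair hne]
  ext f
  constructor
  · rintro ⟨b, ⟨i, hi, hik, rfl⟩, rfl⟩
    exact ⟨k - i, by omega, by omega, key _ _ (by omega)⟩
  · rintro ⟨i, hi, hik, rfl⟩
    exact ⟨_, ⟨k - i, by omega, by omega, rfl⟩, (key _ _ (by omega)).symm⟩

/-! ### Arithmetic of the generators -/

/-- The generator `a + min(i, k) d` of the semigroup `S_{a,d,k}`, as an element of the semigroup;
the truncation makes it a total function of `i`. -/
def gen (a d : Fin 2 → ℕ) (k i : ℕ) : arithmeticSemigroup a d k :=
  ⟨a + min i k • d, add_smul_mem (min_le_right _ _)⟩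

theorem exists_gen_add_iff (had : (a 0 : ℤ) * d 1 - a 1 * d 0 ≠ 0) {i n m : ℕ} (hi : i ≤ k)
    (hm : n • a + m • d ∈ arithmeticSemigroup a d k) :
    (∃ u, (⟨n • a + m • d, hm⟩ : arithmeticSemigroup a d k) = u + gen a d k i) ↔
      1 ≤ n ∧ i ≤ m ∧ m - i ≤ k * (n - 1) := by
  have h := sle_iff (k := k) had (n := 1) (m := i) (n' := n) (m' := m)
  rw [← h, one_smul, SLE]
  simp only [Subtype.exists, Subtype.ext_iff, AddSubmonoid.coe_add, gen, min_eq_left hi,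
    exists_prop, add_comm, eq_comm]

theorem gen_ne_zero (had : (a 0 : ℤ) * d 1 - a 1 * d 0 ≠ 0) (i : ℕ) : gen a d k i ≠ 0 := by
  intro h
  have := (coord_unique had (n := 1) (m := min i k) (n' := 0) (m' := 0)
    (by simpa [gen, Subtype.ext_iff] using h)).1
  omega

theorem gen_coe {i : ℕ} (hi : i ≤ k) : (gen a d k i : Fin 2 → ℕ) = 1 • a + i • d := by
  simp [gen, min_eq_left hi]

theorem exists_gen_add_of_ne_zero {s : arithmeticSemigroup a d k}
    (hs : s ≠ 0) : ∃ i ≤ k, ∃ u, s = u + gen a d k i := by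
  obtain ⟨s, hs'⟩ := s
  obtain ⟨n, m, h, rfl⟩ := mem_arithmeticSemigroup_iff.1 hs'
  obtain _ | n := n
  · obtain rfl : m = 0 := by simpa using h
    simp [Subtype.ext_iff] at hs
  refine ⟨min m k, min_le_right _ _, ⟨n • a + (m - min m k) • d,
    mem_arithmeticSemigroup_iff.2 ⟨n, _, by rw [mul_add] at h; omega, rfl⟩⟩, ?_⟩
  rw [Subtype.ext_iff, AddSubmonoid.coe_add, gen_coe (min_le_right _ _)]
  obtain ⟨j, hj⟩ : ∃ j, m = j + min m k := ⟨m - min m k, by omega⟩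
  simp only [show m - min m k = j by omega]
  conv_lhs => rw [hj]
  rw [add_smul, add_smul]; abel

/-- The sum `(a + i d) + (a + j d)` equals `(a + (i + j) d) + a` if `i + j ≤ k`, and
`(a + (i + j - k) d) + (a + k d)` otherwise. In the semigroup ring, the square of the graded maximal
ideal is therefore contained in the ideal generated by `t ^ a` and `t ^ (a + k d)`. -/
theorem gen_add_gen {i j : ℕ} (hi : i ≤ k) (hj : j ≤ k) :
    (∃ u, gen a d k i + gen a d k j = u + gen a d k 0) ∨
      ∃ u, gen a d k i + gen a d k j = u + gen a d k k := by
  rcases le_total (i + j) k with h | h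
  · refine Or.inl ⟨gen a d k (i + j), ?_⟩
    rw [Subtype.ext_iff]
    simp only [AddSubmonoid.coe_add, gen_coe hi, gen_coe hj, gen_coe h, gen_coe (Nat.zero_le k)]
    rw [add_smul i j]; simp; abel
  · refine Or.inr ⟨gen a d k (i + j - k), ?_⟩
    rw [Subtype.ext_iff]
    simp only [AddSubmonoid.coe_add, gen_coe hi, gen_coe hj, gen_coe (show i + j - k ≤ k by omega),
      gen_coe le_rfl]
    obtain ⟨l, hl⟩ := Nat.exists_eq_add_of_le h
    rw [show i + j - k = l by omega]
    have : i • d + j • d = k • d + l • d := by rw [← add_smul, ← add_smul, hl]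
    calc _ = 1 • a + 1 • a + (i • d + j • d) := by abel
      _ = _ := by rw [this]; abel

theorem exists_add_gen_zero (had : (a 0 : ℤ) * d 1 - a 1 * d 0 ≠ 0) (hk : 0 < k)
    {s u : arithmeticSemigroup a d k} (h : gen a d k k + s = u + gen a d k 0) :
    ∃ w, s = w + gen a d k 0 := by
  obtain ⟨s, hs⟩ := s
  obtain ⟨n, m, hnm, rfl⟩ := mem_arithmeticSemigroup_iff.1 hs
  rw [exists_gen_add_iff had (Nat.zero_le k)]
  have h1 : gen a d k k + ⟨n • a + m • d, hs⟩ =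
      ⟨(n + 1) • a + (m + k) • d, mem_arithmeticSemigroup_iff.2 ⟨_, _, by
        rw [mul_add]; omega, rfl⟩⟩ := by
    rw [Subtype.ext_iff, AddSubmonoid.coe_add, gen_coe le_rfl]
    simp only [add_smul]; abel
  rw [h1] at h
  have h2 := (exists_gen_add_iff had (Nat.zero_le k) _).1 ⟨u, h⟩
  obtain _ | n := n
  · simp at h2 hnm; omega
  · simp only [mul_add, Nat.add_sub_cancel] at *
    omega

theorem gen_eq_add_gen_iff (had : (a 0 : ℤ) * d 1 - a 1 * d 0 ≠ 0) {i j : ℕ} (hi : i ≤ k)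
    (hj : j ≤ k) {u : arithmeticSemigroup a d k} :
    gen a d k i = u + gen a d k j ↔ u = 0 ∧ i = j := by
  constructor
  · intro h
    obtain ⟨u, hu⟩ := u
    obtain ⟨n, m, hnm, rfl⟩ := mem_arithmeticSemigroup_iff.1 hu
    rw [Subtype.ext_iff, AddSubmonoid.coe_add, gen_coe hi, gen_coe hj] at h
    obtain ⟨h1, h2⟩ := coord_unique had (n := 1) (m := i) (n' := n + 1) (m' := m + j)
      (by rw [h]; simp only [add_smul]; abel)
    obtain rfl : n = 0 := by omega
    obtain rfl : m = 0 := by simpa using hnm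
    exact ⟨by simp [Subtype.ext_iff], by omega⟩
  · rintro ⟨rfl, rfl⟩
    rw [zero_add]

end AffineSemigroup

/-! ### The semigroup ring -/

namespace AffineSemigroup

open RingTheory.Sequence IsLocalRing AddMonoidAlgebra
open scoped Pointwise

variable {a d : Fin 2 → ℕ} {k : ℕ} (K : Type*) [Field K]

/-- The monomial `t ^ (a + i d)` of the semigroup ring, for `i ≤ k`. -/
noncomputable def genMonomial (a d : Fin 2 → ℕ) (k i : ℕ) :
    AddMonoidAlgebra K (arithmeticSemigroup a d k) :=
  AddMonoidAlgebra.of' K _ (gen a d k i)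

theorem mem_span_genMonomial_iff (s : Set ℕ) {f : AddMonoidAlgebra K (arithmeticSemigroup a d k)} :
    f ∈ Ideal.span (genMonomial K a d k '' s) ↔
      ∀ t, f.coeff t ≠ 0 → ∃ i ∈ s, ∃ u, t = u + gen a d k i := by
  have : genMonomial K a d k '' s = AddMonoidAlgebra.of' K _ '' (gen a d k '' s) := by
    rw [Set.image_image]; rfl
  rw [this, AddMonoidAlgebra.mem_ideal_span_of'_image]
  simp

theorem ofList_genMonomial (i j : ℕ) :
    Ideal.ofList [genMonomial K a d k i, genMonomial K a d k j] =
      Ideal.span (genMonomial K a d k '' {i, j}) := by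
  simp [Ideal.ofList_cons, Ideal.span_insert, Set.image_pair]

theorem coeff_mul_genMonomial_add (f : AddMonoidAlgebra K (arithmeticSemigroup a d k)) (i : ℕ)
    (s : arithmeticSemigroup a d k) : (f * genMonomial K a d k i).coeff (s + gen a d k i) =
      f.coeff s := by
  simp [genMonomial, AddMonoidAlgebra.of']

/-- If `(a + k d) + s` lies in `a + S`, then so does `s`; this makes `t ^ (a + k d)` regular modulo
`t ^ a`. -/
theorem isWeaklyRegular_genMonomial (had : (a 0 : ℤ) * d 1 - a 1 * d 0 ≠ 0) (hk : 0 < k) :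
    IsWeaklyRegular (AddMonoidAlgebra K (arithmeticSemigroup a d k))
      [genMonomial K a d k 0, genMonomial K a d k k] := by
  rw [isWeaklyRegular_cons_iff, isWeaklyRegular_singleton_iff]
  constructor
  · intro f g h
    ext s
    have h' : f * genMonomial K a d k 0 = g * genMonomial K a d k 0 := by
      rw [mul_comm f, mul_comm g]; exact h
    rw [← coeff_mul_genMonomial_add K f 0 s, ← coeff_mul_genMonomial_add K g 0 s, h']
  · have hspan : genMonomial K a d k 0 •
          (⊤ : Ideal (AddMonoidAlgebra K (arithmeticSemigroup a d k))) =
        Ideal.span (genMonomial K a d k '' {0}) := by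
      rw [Set.image_singleton, ← Submodule.ideal_span_singleton_smul]; simp
    refine (isSMulRegular_quotient_iff_mem_of_smul_mem _ _).2 fun f hf => ?_
    rw [hspan, mem_span_genMonomial_iff] at hf ⊢
    intro t ht
    rw [smul_eq_mul, mul_comm] at hf
    obtain ⟨i, hi, u, hu⟩ := hf (t + gen a d k k) (by rwa [coeff_mul_genMonomial_add])
    obtain rfl : i = 0 := hi
    rw [add_comm] at hu
    exact ⟨0, rfl, exists_add_gen_zero had hk hu⟩

theorem gradedMaximalIdeal_eq_span (had : (a 0 : ℤ) * d 1 - a 1 * d 0 ≠ 0) :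
    gradedMaximalIdeal K (arithmeticSemigroup a d k) =
      Ideal.span (genMonomial K a d k '' Set.Iic k) := by
  ext f
  rw [mem_gradedMaximalIdeal, mem_span_genMonomial_iff]
  constructor
  · intro h t ht
    exact exists_gen_add_of_ne_zero (by rintro rfl; exact ht h)
  · intro h
    by_contra h0
    obtain ⟨i, -, u, hu⟩ := h 0 h0
    refine gen_ne_zero (k := k) had i ?_
    have := congrArg Subtype.val hu
    rw [AddSubmonoid.coe_add, AddSubmonoid.coe_zero, eq_comm, add_eq_zero] at this
    exact Subtype.ext this.2

theorem gradedMaximalIdeal_eq_sup (had : (a 0 : ℤ) * d 1 - a 1 * d 0 ≠ 0) :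
    gradedMaximalIdeal K (arithmeticSemigroup a d k) =
      Ideal.ofList [genMonomial K a d k 0, genMonomial K a d k k] ⊔
        Ideal.span (Set.range fun i : Fin (k - 1) => genMonomial K a d k (i + 1)) := by
  have : (Set.range fun i : Fin (k - 1) => genMonomial K a d k (i + 1)) =
      genMonomial K a d k '' (Set.range fun i : Fin (k - 1) => (i : ℕ) + 1) := by
    rw [← Set.range_comp]; rfl
  rw [gradedMaximalIdeal_eq_span K had, ofList_genMonomial, this, ← Ideal.span_union,
    ← Set.image_union]
  congr 2
  ext i
  simp only [Set.mem_Iic, Set.mem_union, Set.mem_insert_iff, Set.mem_singleton_iff, Set.mem_range]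
  constructor
  · intro hi
    by_cases h : i = 0 ∨ i = k
    · exact Or.inl h
    · exact Or.inr ⟨⟨i - 1, by omega⟩, by simp; omega⟩
  · rintro ((rfl | rfl) | ⟨j, rfl⟩) <;> omega

theorem gradedMaximalIdeal_mul_self_le (had : (a 0 : ℤ) * d 1 - a 1 * d 0 ≠ 0) :
    gradedMaximalIdeal K (arithmeticSemigroup a d k) * gradedMaximalIdeal K _ ≤
      Ideal.ofList [genMonomial K a d k 0, genMonomial K a d k k] := by
  rw [gradedMaximalIdeal_eq_span K had, Ideal.span_mul_span', Ideal.span_le]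
  rintro _ ⟨_, ⟨i, hi, rfl⟩, _, ⟨j, hj, rfl⟩, rfl⟩
  have hmul : genMonomial K a d k i * genMonomial K a d k j =
      AddMonoidAlgebra.single (gen a d k i + gen a d k j) 1 := by
    simp [genMonomial, AddMonoidAlgebra.of', AddMonoidAlgebra.single_mul_single]
  change genMonomial K a d k i * genMonomial K a d k j ∈ Ideal.ofList _
  rw [ofList_genMonomial, mem_span_genMonomial_iff, hmul]
  intro t ht
  obtain rfl : gen a d k i + gen a d k j = t := by
    by_contra h
    simp [h] at ht
  rcases gen_add_gen (a := a) (d := d) hi hj with h | h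
  · exact ⟨0, by simp, h⟩
  · exact ⟨k, by simp, h⟩

/-- The monomials `t ^ (a + i d)` with `0 < i < k` are linearly independent over `K` modulo `t ^ a`
and `t ^ (a + k d)`: the coefficient of `t ^ (a + i d)` vanishes on the ideal, and in the sum it is
the constant coefficient of the factor of that monomial. -/
theorem mem_gradedMaximalIdeal_of_sum_mem (had : (a 0 : ℤ) * d 1 - a 1 * d 0 ≠ 0)
    (f : Fin (k - 1) → AddMonoidAlgebra K (arithmeticSemigroup a d k))
    (hf : ∑ i, f i * genMonomial K a d k (i + 1) ∈
      Ideal.ofList [genMonomial K a d k 0, genMonomial K a d k k])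
    (i : Fin (k - 1)) : f i ∈ gradedMaximalIdeal K (arithmeticSemigroup a d k) := by
  rw [mem_gradedMaximalIdeal]
  rw [ofList_genMonomial, mem_span_genMonomial_iff] at hf
  have hcoeff : (∑ i, f i * genMonomial K a d k (i + 1)).coeff (gen a d k (i + 1)) =
      (f i).coeff 0 := by
    rw [AddMonoidAlgebra.coeff_sum, Finsupp.finsetSum_apply, Finset.sum_eq_single i]
    · simpa using coeff_mul_genMonomial_add K (f i) (i + 1) 0
    · intro j _ hj
      refine AddMonoidAlgebra.coeff_mul_single_of_forall_add_ne _ _ fun u hu => hj ?_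
      have := ((gen_eq_add_gen_iff had (by omega) (by omega)).1 hu.symm).2
      ext; omega
    · simp
  by_contra h
  rw [← hcoeff] at h
  obtain ⟨j, hj, u, hu⟩ := hf _ h
  have hjk : j = 0 ∨ j = k := hj
  have := ((gen_eq_add_gen_iff had (by omega) (by omega)).1 hu).2
  omega

theorem isNoetherianRing_arithmeticSemigroup :
    IsNoetherianRing (AddMonoidAlgebra K (arithmeticSemigroup a d k)) := by
  have hfin : (arithmeticSequence a d k).Finite :=
    ((Set.finite_Iic k).image fun i => a + i • d).subset fun v ⟨i, hi, hv⟩ => ⟨i, hi, hv.symm⟩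
  have : AddMonoid.FG (arithmeticSemigroup a d k) :=
    (AddMonoid.fg_iff_addSubmonoid_fg _).2 ((AddSubmonoid.fg_iff _).2 ⟨_, rfl, hfin⟩)
  exact Algebra.FiniteType.isNoetherianRing K _

theorem localSemigroupRing_isCohenMacaulay_and_cmType
    (had : (a 0 : ℤ) * d 1 - a 1 * d 0 ≠ 0) (hk : 2 ≤ k) :
    LocalCM.IsCohenMacaulay (LocalSemigroupRing K (arithmeticSemigroup a d k)) ∧
      LocalCM.cmType (LocalSemigroupRing K (arithmeticSemigroup a d k)) = ((k - 1 : ℕ) : ℕ∞) := by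
  set p := gradedMaximalIdeal K (arithmeticSemigroup a d k) with hp
  have : IsNoetherianRing (Localization.AtPrime p) :=
    IsLocalization.isNoetherianRing p.primeCompl _ (isNoetherianRing_arithmeticSemigroup K)
  have : Nonempty (Fin (k - 1)) := ⟨⟨0, by omega⟩⟩
  have hmap := IsLocalization.AtPrime.map_eq_maximalIdeal p (Localization.AtPrime p)
  set φ := algebraMap (AddMonoidAlgebra K (arithmeticSemigroup a d k)) (Localization.AtPrime p)
  have hreg : IsRegular (Localization.AtPrime p)
      ([genMonomial K a d k 0, genMonomial K a d k k].map φ) := by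
    refine (isWeaklyRegular_genMonomial K had (by omega)).isRegular_of_isLocalization_of_mem _ p
      fun r hr => ?_
    rw [hp, gradedMaximalIdeal_eq_sup K had]
    exact Ideal.mem_sup_left (Ideal.subset_span hr)
  have hsq : maximalIdeal (Localization.AtPrime p) * maximalIdeal _ ≤
      Ideal.ofList ([genMonomial K a d k 0, genMonomial K a d k k].map φ) := by
    rw [← hmap, ← Ideal.map_mul, ← Ideal.map_ofList]
    exact Ideal.map_mono (gradedMaximalIdeal_mul_self_le K had)
  refine ⟨LocalCM.isCohenMacaulay_of_isRegular hreg (n := 2) (by rwa [pow_two]), ?_⟩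
  rw [LocalCM.cmType_eq_card hreg (v := fun i : Fin (k - 1) => φ (genMonomial K a d k (i + 1))) hsq,
    Fintype.card_fin]
  · rw [← hmap]
    refine (congrArg (Ideal.map φ) (gradedMaximalIdeal_eq_sup K had)).trans ?_
    rw [Ideal.map_sup, Ideal.map_ofList, Ideal.map_span,
      ← Set.range_comp]
    rfl
  · intro c hc
    rw [← Ideal.map_ofList] at hc
    exact LocalCM.mem_maximalIdeal_of_sum_mem_map p (mem_gradedMaximalIdeal_of_sum_mem K had) c hc

end AffineSemigroup

theorem mainTheorem2 (a d : Fin 2 → ℕ)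
    (had : LinearIndependent ℚ ![AffineSemigroup.toRat a, AffineSemigroup.toRat d])
    (k : ℕ) (hk : 2 ≤ k)
    (hmin : AffineSemigroup.IsMinimalGeneratingSet (AffineSemigroup.arithmeticSemigroup a d k)
      (AffineSemigroup.arithmeticSequence a d k)) :
    AffineSemigroup.IsSimplicial (AffineSemigroup.arithmeticSemigroup a d k) ∧
    AffineSemigroup.QF (AffineSemigroup.arithmeticSemigroup a d k) =
      {f | ∃ i : ℕ, 1 ≤ i ∧ i ≤ k - 1 ∧ f = -(AffineSemigroup.toInt (a + i • d))} ∧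
    ∀ (K : Type*) [Field K],
      LocalCM.IsCohenMacaulay
        (AffineSemigroup.LocalSemigroupRing K (AffineSemigroup.arithmeticSemigroup a d k)) ∧
      LocalCM.cmType
        (AffineSemigroup.LocalSemigroupRing K (AffineSemigroup.arithmeticSemigroup a d k)) =
          ((k - 1 : ℕ) : ℕ∞) := by
  have hdet := AffineSemigroup.det_ne_zero had
  exact ⟨AffineSemigroup.isSimplicial_arithmeticSemigroup had (by omega),
    AffineSemigroup.QF_arithmeticSemigroup hdet hk,
    fun K _ => AffineSemigroup.localSemigroupRing_isCohenMacaulay_and_cmType K hdet hk⟩
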